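/- Let $X$ be a finite set and let $r\colon X\times X\to X\times X$, $r(x,y)=(\sigma_x(y),\tau_y(x))$, be a bijective map such that all the maps $\sigma_x,\tau_x\colon X\to X$ ($x\in X$) are bijective and $r$ satisfies the Yang–Baxter equation $r_1r_2r_1=r_2r_1r_2$ on $X\times X\times X$, where $r_1=r\times\mathrm{Id}_X$ and $r_2=\mathrm{Id}_X\times r$. Let $$G_{(X,r)}=\langle\, X \mid xy=\sigma_x(y)\,\tau_y(x)\ \text{ for all } x,y\in X\,\rangle$$ be the structure group of $(X,r)$, and let $k_r$ be the number of orbits of $X$ under the group of permutations of $X$ generated by all the maps $\sigma_z$ and $\tau_z$, $z\in X$. Then the abelianization $\operatorname{Ab} G_{(X,r)}$ of the structure group has rank $k_r$, where the rank of an abelian group is the maximal number of $\mathbb{Z}$-linearly independent elements. -/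

import Mathlib

namespace YangBaxter

variable {X : Type*}

/-- `r₁ = r × Id` on `X × X × X`. -/
def onFirstTwo (r : X × X → X × X) (p : X × X × X) : X × X × X :=
  ((r (p.1, p.2.1)).1, (r (p.1, p.2.1)).2, p.2.2)

/-- `r₂ = Id × r` on `X × X × X`. -/
def onLastTwo (r : X × X → X × X) (p : X × X × X) : X × X × X :=
  (p.1, r p.2)

/-- The component `σ_x` of `r`, where `r (x, y) = (σ_x y, τ_y x)`. -/
def sigma (r : X × X → X × X) (x : X) : X → X := fun y => (r (x, y)).1

/-- The component `τ_y` of `r`, where `r (x, y) = (σ_x y, τ_y x)`. -/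
def tau (r : X × X → X × X) (y : X) : X → X := fun x => (r (x, y)).2

/-- `(X, r)` is an invertible non-degenerate set-theoretic solution of the Yang-Baxter equation.
Finiteness of `X` is required separately. -/
structure IsSolution (r : X × X → X × X) : Prop where
  bijective : Function.Bijective r
  yangBaxter : onFirstTwo r ∘ onLastTwo r ∘ onFirstTwo r =
    onLastTwo r ∘ onFirstTwo r ∘ onLastTwo r
  sigma_bijective : ∀ x, Function.Bijective (sigma r x)
  tau_bijective : ∀ y, Function.Bijective (tau r y)

/-- The relators `(x y) (σ_x(y) τ_y(x))⁻¹` for `x, y ∈ X`. -/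
def relators (r : X × X → X × X) : Set (FreeGroup X) :=
  {w | ∃ x y : X, w = (FreeGroup.of x * FreeGroup.of y) *
    (FreeGroup.of (sigma r x y) * FreeGroup.of (tau r y x))⁻¹}

/-- The structure group `⟨X | x y = σ_x(y) τ_y(x) for all x, y ∈ X⟩`. -/
abbrev StructureGroup (r : X × X → X × X) : Type _ := PresentedGroup (relators r)

/-- The group of permutations of `X` generated by all the maps `σ_z` and `τ_z`. -/
def permGroup (r : X × X → X × X) : Subgroup (Equiv.Perm X) :=
  Subgroup.closure {f | ∃ z : X, ⇑f = sigma r z ∨ ⇑f = tau r z}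

/-- The set of orbits of `X` with respect to all the maps `σ_z` and `τ_z`. -/
abbrev Orbits (r : X × X → X × X) : Type _ := MulAction.orbitRel.Quotient (permGroup r) X

end YangBaxter

namespace YangBaxter

/-! Sending each generator to its orbit maps the abelianization onto the free abelian group on the
orbits, so it suffices that the kernel is torsion. An integer functional restricts to `f : X → ℤ`
with `f x + f y = f (σ_x y) + f (τ_y x)`. Finiteness forces such an `f` to be constant on orbits
(`invariant_sigma_tau`), so every functional vanishes on the kernel; in a finitely generated abelian
group this makes the kernel torsion. -/

/-- A bijection of a finite type that preserves a set also preserves its complement. -/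
theorem mem_of_map_mem_of_mapsTo {X : Type*} [Finite X] {g : X → X} (hg : Function.Injective g)
    {s : Set X} (hs : Set.MapsTo g s s) {x : X} (hx : g x ∈ s) : x ∈ s := by
  obtain ⟨y, hy, hyx⟩ :=
    ((s.toFinite.injOn_iff_bijOn_of_mapsTo hs).1 hg.injOn).surjOn hx
  exact hg hyx ▸ hy

/-- On a finite set, an integer-valued additive invariant of a nondegenerate map `r` is invariant under
all the maps `σ_z` and `τ_z`. -/
theorem invariant_sigma_tau {X : Type*} [Finite X] {r : X × X → X × X}
    (hσ : ∀ x, Function.Bijective (sigma r x)) (hτ : ∀ y, Function.Bijective (tau r y))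
    (f : X → ℤ) (hf : ∀ x y, f x + f y = f (sigma r x y) + f (tau r y x)) (x : X) :
    ∀ z, f (sigma r z x) = f x ∧ f (tau r z x) = f x := by
  have : Fintype X := Fintype.ofFinite X
  -- Induction runs downward from the largest values of `f`: `ih` covers all `w` with `f x < f w`.
  have wf : WellFounded (fun a b : X => f b < f a) :=
    Finite.wellFounded_of_trans_of_irrefl (r := InvImage (· > ·) f)
  induction x using wf.induction with
  | _ x ih =>
  -- By `ih`, `τ_y` preserves `{f > f x}`, hence also its complement, which contains `x`.
  have hle : ∀ y, f (tau r y x) ≤ f x := fun y => by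
    by_contra! h
    have := mem_of_map_mem_of_mapsTo (hτ y).injective (s := {w | f x < f w})
      (fun w (hw : f x < f w) => by
        change f x < f (tau r y w)
        rwa [(ih w hw y).2]) h
    exact lt_irrefl (f x) this
  -- `σ_x` permutes `X`, so the termwise inequality `hge` must be an equality everywhere.
  have hsum : ∑ y, f (sigma r x y) = ∑ y, f y :=
    (Equiv.ofBijective _ (hσ x)).sum_comp f
  have hge : ∀ y ∈ Finset.univ, f y ≤ f (sigma r x y) := fun y _ => by
    linarith [hf x y, hle y]
  have htau : ∀ z, f (tau r z x) = f x := fun z => by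
    linarith [hf x z, (Finset.sum_eq_sum_iff_of_le hge).1 hsum.symm z (Finset.mem_univ z)]
  have hle' : ∀ y, f (sigma r y x) ≤ f x := fun y => by
    by_contra! h
    have := mem_of_map_mem_of_mapsTo (hσ y).injective (s := {w | f x < f w})
      (fun w (hw : f x < f w) => by
        change f x < f (sigma r y w)
        rwa [(ih w hw y).1]) h
    exact lt_irrefl (f x) this
  have hsum' : ∑ y, f (tau r x y) = ∑ y, f y :=
    (Equiv.ofBijective _ (hτ x)).sum_comp f
  have hge' : ∀ y ∈ Finset.univ, f y ≤ f (tau r x y) := fun y _ => by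
    linarith [hf y x, hle' y]
  exact fun z => ⟨by
    linarith [hf z x, (Finset.sum_eq_sum_iff_of_le hge').1 hsum'.symm z (Finset.mem_univ z)],
    htau z⟩

/-- A function invariant under all the maps `σ_z` and `τ_z` is constant on orbits. -/
theorem eq_of_orbit_eq {X Y : Type*} {r : X × X → X × X} {f : X → Y}
    (hf : ∀ x z, f (sigma r z x) = f x ∧ f (tau r z x) = f x) {x y : X}
    (h : (Quotient.mk'' x : Orbits r) = Quotient.mk'' y) : f x = f y := by
  have key : ∀ g ∈ permGroup r, ∀ w, f (g w) = f w := fun g hg => by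
    induction hg using Subgroup.closure_induction with
    | mem g hg =>
      obtain ⟨z, hz | hz⟩ := hg
      · exact fun w => hz ▸ (hf w z).1
      · exact fun w => hz ▸ (hf w z).2
    | one => exact fun _ => rfl
    | mul g g' _ _ h h' => exact fun w => (h _).trans (h' w)
    | inv g _ h => exact fun w => by simpa using (h (g⁻¹ w)).symm
  obtain ⟨g, rfl⟩ := MulAction.orbitRel_apply.1 (Quotient.exact h)
  exact key g g.2 y

theorem orbit_sigma {X : Type*} {r : X × X → X × X}
    (hσ : ∀ x, Function.Bijective (sigma r x)) (z x : X) :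
    (Quotient.mk'' (sigma r z x) : Orbits r) = Quotient.mk'' x :=
  Quotient.sound <| MulAction.orbitRel_apply.2
    ⟨⟨Equiv.ofBijective _ (hσ z), Subgroup.subset_closure ⟨z, .inl rfl⟩⟩, rfl⟩

theorem orbit_tau {X : Type*} {r : X × X → X × X}
    (hτ : ∀ y, Function.Bijective (tau r y)) (z x : X) :
    (Quotient.mk'' (tau r z x) : Orbits r) = Quotient.mk'' x :=
  Quotient.sound <| MulAction.orbitRel_apply.2
    ⟨⟨Equiv.ofBijective _ (hτ z), Subgroup.subset_closure ⟨z, .inr rfl⟩⟩, rfl⟩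

/-- The class of a generator in the abelianized structure group. -/
def abGen {X : Type*} (r : X × X → X × X) (x : X) :
    Additive (Abelianization (StructureGroup r)) :=
  Additive.ofMul (Abelianization.of (PresentedGroup.of x))

theorem abGen_add {X : Type*} (r : X × X → X × X) (x y : X) :
    abGen r x + abGen r y = abGen r (sigma r x y) + abGen r (tau r y x) := by
  have h := PresentedGroup.one_of_mem (rels := relators r) ⟨x, y, rfl⟩
  rw [map_mul, map_inv, mul_inv_eq_one, map_mul, map_mul] at h
  exact congrArg (fun g => Additive.ofMul (Abelianization.of g)) h

/-- Linear maps out of the abelianized structure group are determined by the generators. -/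
theorem linearMap_ext {X M : Type*} [AddCommGroup M] {r : X × X → X × X}
    {f g : Additive (Abelianization (StructureGroup r)) →ₗ[ℤ] M}
    (h : ∀ x, f (abGen r x) = g (abGen r x)) : f = g := by
  have : f.toAddMonoidHom.toMultiplicativeRight = g.toAddMonoidHom.toMultiplicativeRight :=
    Abelianization.hom_ext _ _ (PresentedGroup.ext h)
  ext a
  exact DFunLike.congr_fun this a.toMul

/-- The degree map, which sends each generator to its orbit. -/
noncomputable def orbitDegree {X : Type*} {r : X × X → X × X}
    (hσ : ∀ x, Function.Bijective (sigma r x)) (hτ : ∀ y, Function.Bijective (tau r y)) :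
    Additive (Abelianization (StructureGroup r)) →ₗ[ℤ] (Orbits r →₀ ℤ) :=
  (MonoidHom.toAdditiveLeft (Abelianization.lift (PresentedGroup.toGroup
    (f := fun x => Multiplicative.ofAdd (Finsupp.single (Quotient.mk'' x : Orbits r) (1 : ℤ)))
    (by
      rintro _ ⟨x, y, rfl⟩
      simp only [map_mul, map_inv, FreeGroup.lift_apply_of, orbit_sigma hσ, orbit_tau hτ]
      rw [mul_inv_eq_one, mul_comm])))).toIntLinearMap

theorem orbitDegree_abGen {X : Type*} {r : X × X → X × X}
    (hσ : ∀ x, Function.Bijective (sigma r x)) (hτ : ∀ y, Function.Bijective (tau r y)) (x : X) :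
    orbitDegree hσ hτ (abGen r x) = Finsupp.single (Quotient.mk'' x) 1 := by
  simp [orbitDegree, abGen]

theorem orbitDegree_surjective {X : Type*} {r : X × X → X × X}
    (hσ : ∀ x, Function.Bijective (sigma r x)) (hτ : ∀ y, Function.Bijective (tau r y)) :
    Function.Surjective (orbitDegree hσ hτ) := by
  rw [← LinearMap.range_eq_top, eq_top_iff, ← Finsupp.basisSingleOne.span_eq, Submodule.span_le]
  rintro _ ⟨o, rfl⟩
  rw [Finsupp.coe_basisSingleOne]
  induction o using Quotient.inductionOn' with
  | _ x => exact ⟨_, orbitDegree_abGen hσ hτ x⟩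

/-- Every integer-valued linear functional factors through the degree map. -/
theorem exists_comp_orbitDegree {X : Type*} [Finite X] {r : X × X → X × X}
    (hσ : ∀ x, Function.Bijective (sigma r x)) (hτ : ∀ y, Function.Bijective (tau r y))
    (f : Additive (Abelianization (StructureGroup r)) →ₗ[ℤ] ℤ) :
    ∃ g : (Orbits r →₀ ℤ) →ₗ[ℤ] ℤ, f = g ∘ₗ orbitDegree hσ hτ := by
  refine ⟨Finsupp.linearCombination ℤ fun o => f (abGen r o.out), linearMap_ext fun x => ?_⟩
  have hinv := invariant_sigma_tau hσ hτ (fun x => f (abGen r x))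
    fun x y => by rw [← map_add, ← map_add, abGen_add]
  simp only [LinearMap.comp_apply, orbitDegree_abGen, Finsupp.linearCombination_single, one_smul]
  exact eq_of_orbit_eq (f := fun x => f (abGen r x)) hinv (Quotient.out_eq' _).symm

/-- An element of a finitely generated abelian group killed by all integer-valued functionals
is torsion. -/
theorem exists_smul_eq_zero_of_forall_dual {A : Type*} [AddCommGroup A] [Module.Finite ℤ A] {a : A}
    (h : ∀ f : A →ₗ[ℤ] ℤ, f a = 0) : ∃ n : ℤ, n ≠ 0 ∧ n • a = 0 := by
  -- Finitely generated and torsion-free over `ℤ` implies free, so functionals separate points of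
  -- the quotient.
  have : Module.Free ℤ (A ⧸ Submodule.torsion ℤ A) := inferInstance
  have h0 : (Submodule.torsion ℤ A).mkQ a = 0 :=
    (Module.forall_dual_apply_eq_zero_iff ℤ _).1 fun f => h (f ∘ₗ Submodule.mkQ _)
  obtain ⟨n, hn⟩ := (Submodule.mem_torsion_iff a).1 ((Submodule.Quotient.mk_eq_zero _).1 h0)
  exact ⟨n, nonZeroDivisors.ne_zero n.2, hn⟩

theorem finite_abelianization {X : Type*} [Finite X] (r : X × X → X × X) :
    Module.Finite ℤ (Additive (Abelianization (StructureGroup r))) := by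
  refine Module.Finite.of_surjective (Finsupp.linearCombination ℤ (abGen r)) ?_
  -- The range is everything because the projection modulo it kills every generator.
  rw [← LinearMap.range_eq_top, ← Submodule.ker_mkQ (LinearMap.range _), LinearMap.ker_eq_top]
  refine linearMap_ext fun x => ?_
  rw [LinearMap.zero_apply, Submodule.mkQ_apply, Submodule.Quotient.mk_eq_zero]
  exact ⟨Finsupp.single x 1, by simp⟩

end YangBaxter

open YangBaxter in
theorem mainTheorem4 {X : Type*} [Finite X] (r : X × X → X × X)
    (hr : YangBaxter.IsSolution r) :
    Module.rank ℤ (Additive (Abelianization (YangBaxter.StructureGroup r))) =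
      (Nat.card (YangBaxter.Orbits r) : Cardinal) := by
  have hσ := hr.sigma_bijective
  have hτ := hr.tau_bijective
  have := finite_abelianization r
  have hker : Module.rank ℤ (LinearMap.ker (orbitDegree hσ hτ)) = 0 := by
    refine rank_eq_zero_iff.2 fun ⟨a, ha⟩ => ?_
    obtain ⟨n, hn, hna⟩ := exists_smul_eq_zero_of_forall_dual (a := a) fun f => by
      obtain ⟨g, rfl⟩ := exists_comp_orbitDegree hσ hτ f
      rw [LinearMap.comp_apply, LinearMap.mem_ker.1 ha, map_zero]
    exact ⟨n, hn, Subtype.ext hna⟩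
  have hrank := rank_quotient_add_rank_of_isDomain (LinearMap.ker (orbitDegree hσ hτ))
  rw [← hrank, hker, add_zero, ((orbitDegree hσ hτ).quotKerEquivOfSurjective
    (orbitDegree_surjective hσ hτ)).rank_eq, rank_finsupp_self, Cardinal.lift_uzero, Nat.cast_card]
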